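/- Simply isotropic space $\mathbb I^3$ is $\mathbb R^3$ with the degenerate inner product $\langle X,Y\rangle=x_1y_1+x_2y_2$. For $c\in\mathbb R$ and a $C^3$ function $z:(0,\infty)\to\mathbb R$, let $M_c^2$ be the helicoidal surface $\mathbf R(u,t)=(u\cos t,\,u\sin t,\,z(u)+ct)$, $u>0$, $t\in\mathbb R$, with the induced metric, and let $\Delta$ be its Laplace–Beltrami operator. Its minimal Gauss map is $\mathbf N_m=(\mathbf R_u\times\mathbf R_t)/X_{12}$, where $\times$ is the Euclidean cross product and $X_{12}$ is the third component of $\mathbf R_u\times\mathbf R_t$. Suppose that $\mathbf N_m$ is of coordinate finite type, i.e. $-\Delta N_m^i=\lambda_iN_m^i$ for $i=1,2,3$ with real constants $\lambda_1,\lambda_2,\lambda_3$, and that $M_c^2$ is not contained in a plane. Call $M_c^2$ bounded near the screw axis if $z$ is bounded on $(0,\varepsilon)$ for some $\varepsilon>0$, and bounded at infinity if $z$ is bounded on $(R,\infty)$ for some $R>0$. Let $J_0,Y_0$ be the Bessel functions of order zero of the first and second kind and $I_0,K_0$ the modified ones. 1. If $M_c^2$ is bounded near the screw axis, then $\lambda_1=\lambda_2=\lambda$;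 if $\lambda\neq0$ then $c=0$; and there are constants $z_0,z_1$ such that for all $u>0$ $$z(u)=\begin{cases} z_0+z_1J_0(\sqrt{\lambda}\,u), & \lambda>0,\\ z_0+z_1u^2, & \lambda=0,\\ z_0+z_1I_0(\sqrt{-\lambda}\,u), & \lambda<0.\end{cases}$$ 2. If $M_c^2$ is bounded at infinity, then $\lambda_1=\lambda_2=\lambda$, and either $M_c^2$ is a right helicoid ($\lambda=0$, $c\ne0$ and $z$ constant), or $\lambda\neq0$, $c=0$ and there are constants $z_0,z_1,z_2$ such that for all $u>0$ $$z(u)=\begin{cases} z_0+z_1J_0(\sqrt{\lambda}\,u)+z_2Y_0(\sqrt{\lambda}\,u), & \lambda>0,\\ z_0+z_2K_0(\sqrt{-\lambda}\,u), & \lambda<0.\end{cases}$$ 3. If $M_c^2$ is bounded both near the screw axis and at infinity, then $\lambda_1=\lambda_2=\lambda$, and either $M_c^2$ is a right helicoid ($\lambda=0$, $c\neq0$ and $z$ constant), or $\lambda>0$, $c=0$ and $z(u)=z_0+z_1J_0(\sqrt{\lambda}\,u)$ for all $u>0$, with constants $z_0,z_1$. -/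

import Mathlib

noncomputable section

namespace SimplyIsotropic

/-! ### Parametrized surfaces in simply isotropic space

Points of the ambient space are triples of reals. A parametrized surface is a map `x : ℝ → ℝ → (Fin 3 → ℝ)`
of two parameters `(u, t)`. -/

/-- Partial derivative in the first parameter. -/
def pd₁ {E : Type} [NormedAddCommGroup E] [NormedSpace ℝ E] (f : ℝ → ℝ → E) (u t : ℝ) : E :=
  deriv (fun s => f s t) u

/-- Partial derivative in the second parameter. -/
def pd₂ {E : Type} [NormedAddCommGroup E] [NormedSpace ℝ E] (f : ℝ → ℝ → E) (u t : ℝ) : E :=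
  deriv (fun s => f u s) t

/-- The (degenerate) isotropic inner product: the last, isotropic, coordinate is ignored. -/
def isoInner (X Y : Fin 3 → ℝ) : ℝ := X 0 * Y 0 + X 1 * Y 1

/-- Coefficients of the first fundamental form induced by the isotropic inner product. -/
def g₁₁ (x : ℝ → ℝ → (Fin 3 → ℝ)) (u t : ℝ) : ℝ := isoInner (pd₁ x u t) (pd₁ x u t)

def g₁₂ (x : ℝ → ℝ → (Fin 3 → ℝ)) (u t : ℝ) : ℝ := isoInner (pd₁ x u t) (pd₂ x u t)

def g₂₂ (x : ℝ → ℝ → (Fin 3 → ℝ)) (u t : ℝ) : ℝ := isoInner (pd₂ x u t) (pd₂ x u t)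

/-- The area density `√(det g)`. -/
def sqrtDet (x : ℝ → ℝ → (Fin 3 → ℝ)) (u t : ℝ) : ℝ :=
  Real.sqrt (g₁₁ x u t * g₂₂ x u t - g₁₂ x u t ^ 2)

/-- The Laplace-Beltrami operator of the induced metric, in the coordinates `(u, t)`:
`Δ f = (1/√g) [∂₁ ((g₂₂ ∂₁ f - g₁₂ ∂₂ f)/√g) + ∂₂ ((g₁₁ ∂₂ f - g₁₂ ∂₁ f)/√g)]`. -/
def laplaceBeltrami (x : ℝ → ℝ → (Fin 3 → ℝ)) (f : ℝ → ℝ → ℝ) (u t : ℝ) : ℝ :=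
  (1 / sqrtDet x u t) *
    (pd₁ (fun u t => (g₂₂ x u t * pd₁ f u t - g₁₂ x u t * pd₂ f u t) / sqrtDet x u t) u t
      + pd₂ (fun u t => (g₁₁ x u t * pd₂ f u t - g₁₂ x u t * pd₁ f u t) / sqrtDet x u t) u t)

/-- The minor `X₁₂`, nonzero exactly when the surface is admissible at `(u, t)`. -/
def minor₁₂ (x : ℝ → ℝ → (Fin 3 → ℝ)) (u t : ℝ) : ℝ :=
  pd₁ x u t 0 * pd₂ x u t 1 - pd₁ x u t 1 * pd₂ x u t 0

/-- The minimal normal (minimal Gauss map) `N_m = (x₁ × x₂) / X₁₂`. -/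
def minimalNormal (x : ℝ → ℝ → (Fin 3 → ℝ)) (u t : ℝ) : Fin 3 → ℝ :=
  (minor₁₂ x u t)⁻¹ • crossProduct (pd₁ x u t) (pd₂ x u t)

/-- The minimal Gauss map of the surface `x`, parametrized over `D`, is of coordinate finite type
with eigenvalues `ev`: `-Δ N_m = diag(ev) N_m` on `D`. -/
def FiniteTypeMinimalNormal (x : ℝ → ℝ → (Fin 3 → ℝ)) (D : Set (ℝ × ℝ)) (ev : Fin 3 → ℝ) : Prop :=
  ∀ p ∈ D, ∀ i : Fin 3,
    -laplaceBeltrami x (fun u t => minimalNormal x u t i) p.1 p.2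
      = ev i * minimalNormal x p.1 p.2 i

/-! ### Helicoidal surfaces -/

/-- The helicoidal surface with generating curve `(u, 0, z u)` and pitch `c`. -/
def helicoidal (z : ℝ → ℝ) (c : ℝ) (u t : ℝ) : Fin 3 → ℝ :=
  ![u * Real.cos t, u * Real.sin t, z u + c * t]

/-- The parameter domain `u > 0`, `t ∈ ℝ`. -/
def helicoidalDomain : Set (ℝ × ℝ) := {p | 0 < p.1}

/-- The helicoidal surface as a subset of the ambient space. -/
def helicoidalSet (z : ℝ → ℝ) (c : ℝ) : Set (Fin 3 → ℝ) :=
  (fun p : ℝ × ℝ => helicoidal z c p.1 p.2) '' helicoidalDomain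

/-- A set is planar if it lies in some affine plane. -/
def IsPlanar (M : Set (Fin 3 → ℝ)) : Prop :=
  ∃ n : Fin 3 → ℝ, n ≠ 0 ∧ ∃ d : ℝ, ∀ p ∈ M, n ⬝ᵥ p = d

/-- The generating curve stays bounded as it approaches the screw axis. -/
def BoundedNearAxis (z : ℝ → ℝ) : Prop :=
  ∃ ε > 0, ∃ B : ℝ, ∀ u, 0 < u → u < ε → |z u| ≤ B

/-- The height of the generating curve stays bounded far away from the screw axis. -/
def BoundedAtInfinity (z : ℝ → ℝ) : Prop :=
  ∃ R : ℝ, ∃ B : ℝ, ∀ u, 0 < u → R < u → |z u| ≤ B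

/-! ### Bessel functions of order zero -/

/-- Bessel function of the first kind `J₀`. -/
def besselJ₀ (x : ℝ) : ℝ :=
  ∑' k : ℕ, (-1) ^ k * (x ^ 2 / 4) ^ k / (k.factorial : ℝ) ^ 2

/-- Modified Bessel function of the first kind `I₀`. -/
def besselI₀ (x : ℝ) : ℝ :=
  ∑' k : ℕ, (x ^ 2 / 4) ^ k / (k.factorial : ℝ) ^ 2

/-- Bessel function of the second kind `Y₀`, for `x > 0`:
`Y₀(x) = (2/π) (log (x/2) + γ) J₀(x) + (2/π) ∑_{k ≥ 1} (-1)^(k+1) H_k (x²/4)^k / (k!)²`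
(the term `k = 0` vanishes since `H_0 = 0`). -/
def besselY₀ (x : ℝ) : ℝ :=
  2 / Real.pi * (Real.log (x / 2) + Real.eulerMascheroniConstant) * besselJ₀ x
    + 2 / Real.pi * ∑' k : ℕ,
        (-1) ^ (k + 1) * (harmonic k : ℝ) * (x ^ 2 / 4) ^ k / (k.factorial : ℝ) ^ 2

/-- Modified Bessel function of the second kind (Macdonald function) `K₀`, for `x > 0`:
`K₀(x) = ∫₀^∞ exp(-x cosh s) ds`. -/
def besselK₀ (x : ℝ) : ℝ :=
  ∫ s in Set.Ioi (0 : ℝ), Real.exp (-x * Real.cosh s)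

end SimplyIsotropic

end

/-!
The isotropic metric ignores the third coordinate, so a helicoidal surface carries the flat metric
`du² + u² dt²` and its Laplace-Beltrami operator is the planar Laplacian in polar coordinates
(`laplaceBeltrami_helicoidal`). The minimal normal is
`(c/u sin t - z' cos t, -z' sin t - c/u cos t, 1)`, where `sin t / u` and `cos t / u` are harmonic.
Comparing coefficients of `cos t` and `sin t` in `-Δ Nᵢ = lᵢ Nᵢ` therefore gives `lᵢ c = 0` and
`(z'' + z'/u)' = -lᵢ z'` for `i = 1, 2` (`FiniteTypeMinimalNormal.generatingCurve`). If `z'` is not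
identically zero, the two eigenvalues agree; if `z` is constant, then `c ≠ 0`, as the surface is not
a plane, and both eigenvalues vanish.

With `l` the common eigenvalue, `z'' + z'/u + l z` is constant. For `l = 0` this integrates to
`z = z₀ + a u² + b log u`. For `l ≠ 0` the function `z`, up to an additive constant, solves Bessel's
equation of order zero, and it has to be shown that `J₀, Y₀`, respectively `I₀, K₀`, span its
solutions. That they are solutions follows from their power series, for `K₀` by differentiation
under the integral sign. Since `u` times a Wronskian is constant (`IsBesselSolution.wronskian`), the
coefficients of a solution in terms of `v₁, v₂` are quotients of such constants, once the Wronskian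
of `v₁, v₂` is nonzero; it is, because `v₁` tends to `1` at the axis and `v₂` is unbounded there
(`IsBesselSolution.eq_combination`).

The boundedness assumptions then select solutions: near the axis `Y₀`, `K₀` and `log` are unbounded
while the other solutions are bounded; at infinity `K₀` is bounded while `I₀`, and every nonconstant
combination of `u²` and `log u`, is not.
-/

namespace SimplyIsotropic

open Filter Topology MeasureTheory

/-! ### Power series with factorially decaying coefficients -/

/-- The sum of the power series with coefficients `a`. -/
noncomputable def powSum (a : ℕ → ℝ) (y : ℝ) : ℝ := ∑' k, a k * y ^ k

/-- The coefficients of the termwise derivative of `∑ a k * y ^ k`. -/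
def derivCoeff (a : ℕ → ℝ) (k : ℕ) : ℝ := (k + 1) * a (k + 1)

/-- Coefficients bounded by those of a multiple of the exponential series. The condition gives
convergence everywhere and passes to `derivCoeff a` with the same constant. -/
def FactorialDecay (a : ℕ → ℝ) : Prop := ∃ C : ℝ, ∀ k, |a k| ≤ C / k.factorial

lemma FactorialDecay.derivCoeff {a : ℕ → ℝ} (ha : FactorialDecay a) :
    FactorialDecay (derivCoeff a) := by
  obtain ⟨C, hC⟩ := ha
  refine ⟨C, fun k => ?_⟩
  have h := hC (k + 1)
  have hk : (0 : ℝ) < k + 1 := by positivity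
  rw [SimplyIsotropic.derivCoeff, abs_mul, abs_of_pos hk]
  calc ((k : ℝ) + 1) * |a (k + 1)| ≤ (k + 1) * (C / (k + 1).factorial) := by gcongr
    _ = C / k.factorial := by
      rw [Nat.factorial_succ]; push_cast; field_simp

lemma FactorialDecay.summable {a : ℕ → ℝ} (ha : FactorialDecay a) (y : ℝ) :
    Summable fun k => a k * y ^ k := by
  obtain ⟨C, hC⟩ := ha
  refine Summable.of_norm_bounded ((Real.summable_pow_div_factorial |y|).mul_left C) fun k => ?_
  rw [Real.norm_eq_abs, abs_mul, abs_pow]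
  calc |a k| * |y| ^ k ≤ C / k.factorial * |y| ^ k := by gcongr; exact hC k
    _ = _ := by ring

lemma FactorialDecay.hasDerivAt_powSum {a : ℕ → ℝ} (ha : FactorialDecay a) (y : ℝ) :
    HasDerivAt (powSum a) (powSum (SimplyIsotropic.derivCoeff a) y) y := by
  obtain ⟨C, hC⟩ := id ha
  have hC0 : 0 ≤ C := by simpa using (abs_nonneg _).trans (hC 0)
  have hu : Summable fun k : ℕ => C / k.factorial * (k * (|y| + 1) ^ (k - 1)) := by
    rw [← summable_nat_add_iff 1]
    refine ((Real.summable_pow_div_factorial (|y| + 1)).mul_left C).congr fun k => ?_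
    rw [Nat.factorial_succ]; push_cast; field_simp
  have hbd : ∀ (k : ℕ) (x : ℝ), x ∈ Metric.ball (0 : ℝ) (|y| + 1) →
      ‖a k * (k * x ^ (k - 1))‖ ≤ C / k.factorial * (k * (|y| + 1) ^ (k - 1)) := by
    intro k x hx
    have hx' : |x| ≤ |y| + 1 := by simpa using (mem_ball_zero_iff.1 hx).le
    rw [Real.norm_eq_abs, abs_mul, abs_mul, abs_pow, Nat.abs_cast]
    gcongr
    exact hC k
  have hy : y ∈ Metric.ball (0 : ℝ) (|y| + 1) := by simp
  have h := hasDerivAt_tsum_of_isPreconnected (g := fun k x => a k * x ^ k) hu Metric.isOpen_ball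
    (convex_ball (0 : ℝ) (|y| + 1)).isPreconnected
    (fun k x _ => (hasDerivAt_pow k x).const_mul (a k)) hbd hy (ha.summable y) hy
  convert! h using 1
  rw [(Summable.of_norm_bounded hu fun k => hbd k y hy).tsum_eq_zero_add]
  simp only [powSum, SimplyIsotropic.derivCoeff, Nat.cast_zero, zero_mul, mul_zero, zero_add,
    Nat.add_sub_cancel, Nat.cast_add, Nat.cast_one]
  exact tsum_congr fun k => by ring

/-- In terms of coefficients, the operator `y f'' + f'` shifts the index by one and multiplies by
`(k + 1)²`; this is where the squared factorials of the Bessel series come from. -/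
lemma FactorialDecay.euler_powSum {a : ℕ → ℝ} (ha : FactorialDecay a) (y : ℝ) :
    y * powSum (SimplyIsotropic.derivCoeff (SimplyIsotropic.derivCoeff a)) y
      + powSum (SimplyIsotropic.derivCoeff a) y
      = powSum (fun k => (k + 1) ^ 2 * a (k + 1)) y := by
  have h1 := ha.derivCoeff.summable y
  have h2 := (ha.derivCoeff.derivCoeff.summable y).mul_left y
  have h3 : Summable fun k : ℕ => k * SimplyIsotropic.derivCoeff a k * y ^ k := by
    rw [← summable_nat_add_iff 1]
    refine h2.congr fun k => ?_
    simp only [SimplyIsotropic.derivCoeff]; push_cast; ring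
  have h4 : y * powSum (SimplyIsotropic.derivCoeff (SimplyIsotropic.derivCoeff a)) y
      = ∑' k : ℕ, k * SimplyIsotropic.derivCoeff a k * y ^ k := by
    rw [h3.tsum_eq_zero_add, powSum, ← tsum_mul_left]
    simp only [Nat.cast_zero, zero_mul, zero_add]
    refine tsum_congr fun k => ?_
    simp only [SimplyIsotropic.derivCoeff]; push_cast; ring
  rw [h4, powSum, ← h3.tsum_add h1]
  refine tsum_congr fun k => ?_
  simp only [SimplyIsotropic.derivCoeff]; ring

/-- Coefficients of the entire function `E` with `J₀ x = E (-x²/4)` and `I₀ x = E (x²/4)`. -/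
noncomputable def besselCoeff (k : ℕ) : ℝ := 1 / (k.factorial : ℝ) ^ 2

/-- Coefficients of the entire function `G` occurring, at `-x²/4`, in the non-logarithmic part of
`Y₀`. -/
noncomputable def harmonicCoeff (k : ℕ) : ℝ := (harmonic k : ℝ) / (k.factorial : ℝ) ^ 2

lemma besselCoeff_decay : FactorialDecay besselCoeff := by
  refine ⟨1, fun k => ?_⟩
  have h : (1 : ℝ) ≤ k.factorial := by exact_mod_cast k.factorial_pos
  rw [besselCoeff, abs_of_nonneg (by positivity)]
  gcongr
  nlinarith

lemma harmonic_le_factorial (k : ℕ) : (harmonic k : ℝ) ≤ k.factorial := by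
  have h : harmonic k ≤ k := by
    rw [harmonic]
    calc ∑ i ∈ Finset.range k, ((i + 1 : ℕ) : ℚ)⁻¹ ≤ ∑ i ∈ Finset.range k, (1 : ℚ) :=
          Finset.sum_le_sum fun i _ => inv_le_one_of_one_le₀ (by exact_mod_cast i.succ_pos)
      _ = k := by simp
  calc (harmonic k : ℝ) ≤ k := by exact_mod_cast h
    _ ≤ k.factorial := by exact_mod_cast k.self_le_factorial

lemma harmonic_nonneg (k : ℕ) : (0 : ℝ) ≤ harmonic k := by
  have h : 0 ≤ harmonic k := Finset.sum_nonneg fun i _ => by positivity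
  exact_mod_cast h

lemma harmonicCoeff_decay : FactorialDecay harmonicCoeff := by
  refine ⟨1, fun k => ?_⟩
  have h0 := harmonic_nonneg k
  have h1 := harmonic_le_factorial k
  have hk : (0 : ℝ) < k.factorial := by positivity
  rw [harmonicCoeff, abs_of_nonneg (by positivity), div_le_div_iff₀ (by positivity) hk]
  nlinarith

/-- `y E'' + E' = E`. -/
lemma besselCoeff_ode (y : ℝ) :
    y * powSum (derivCoeff (derivCoeff besselCoeff)) y + powSum (derivCoeff besselCoeff) y
      = powSum besselCoeff y := by
  rw [besselCoeff_decay.euler_powSum]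
  congr 1
  ext k
  simp only [besselCoeff, Nat.factorial_succ]; push_cast; field_simp

/-- `y G'' + G' = G + E'`: the extra term compensates the cross term of the Laplacian of
`log u * E (-u²/4)`. -/
lemma harmonicCoeff_ode (y : ℝ) :
    y * powSum (derivCoeff (derivCoeff harmonicCoeff)) y + powSum (derivCoeff harmonicCoeff) y
      = powSum harmonicCoeff y + powSum (derivCoeff besselCoeff) y := by
  rw [harmonicCoeff_decay.euler_powSum, powSum, powSum, powSum,
    ← (harmonicCoeff_decay.summable y).tsum_add (besselCoeff_decay.derivCoeff.summable y)]
  refine tsum_congr fun k => ?_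
  simp only [harmonicCoeff, derivCoeff, besselCoeff, Nat.factorial_succ, harmonic_succ]
  push_cast; field_simp

lemma besselI₀_eq (x : ℝ) : besselI₀ x = powSum besselCoeff (x ^ 2 / 4) :=
  tsum_congr fun k => by rw [besselCoeff]; ring

lemma besselJ₀_eq (x : ℝ) : besselJ₀ x = powSum besselCoeff (-(x ^ 2 / 4)) :=
  tsum_congr fun k => by rw [besselCoeff, neg_pow (x ^ 2 / 4)]; ring

lemma besselY₀_eq (x : ℝ) : besselY₀ x =
    2 / Real.pi * ((Real.log (x / 2) + Real.eulerMascheroniConstant)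
      * powSum besselCoeff (-(x ^ 2 / 4)) - powSum harmonicCoeff (-(x ^ 2 / 4))) := by
  have h : ∑' k : ℕ, (-1) ^ (k + 1) * (harmonic k : ℝ) * (x ^ 2 / 4) ^ k / (k.factorial : ℝ) ^ 2
      = -powSum harmonicCoeff (-(x ^ 2 / 4)) := by
    rw [powSum, ← tsum_neg]
    exact tsum_congr fun k => by rw [harmonicCoeff, neg_pow (x ^ 2 / 4)]; ring
  rw [besselY₀, h, besselJ₀_eq]; ring

/-! ### Bessel's equation of order zero and its solutions -/

/-- `w` solves Bessel's equation `w'' + w'/u + l w = 0` on the half-line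
`u > 0`, and `w'` is its derivative there; carrying `w'` along avoids iterated `deriv`. -/
def IsBesselSolution (l : ℝ) (w w' : ℝ → ℝ) : Prop :=
  ∀ u, 0 < u → HasDerivAt w (w' u) u ∧ HasDerivAt w' (-(w' u) / u - l * w u) u

lemma IsBesselSolution.comp_mul {l : ℝ} {w w' : ℝ → ℝ} (h : IsBesselSolution l w w') {a : ℝ}
    (ha : 0 < a) :
    IsBesselSolution (l * a ^ 2) (fun u => w (a * u)) (fun u => a * w' (a * u)) := by
  intro u hu
  obtain ⟨h1, h2⟩ := h (a * u) (by positivity)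
  have hm : HasDerivAt (fun s => a * s) a u := by simpa using (hasDerivAt_id u).const_mul a
  refine ⟨?_, ?_⟩
  · convert! h1.comp u hm using 1; ring
  · convert! (h2.comp u hm).const_mul a using 1; field_simp

lemma isBesselSolution_powSum (l : ℝ) :
    IsBesselSolution l (fun u => powSum besselCoeff (-(l * u ^ 2 / 4)))
      (fun u => powSum (derivCoeff besselCoeff) (-(l * u ^ 2 / 4)) * (-(l * u / 2))) := by
  intro u hu
  have hy : HasDerivAt (fun u : ℝ => -(l * u ^ 2 / 4)) (-(l * u / 2)) u := by
    convert! (((hasDerivAt_pow 2 u).const_mul l).div_const 4).neg using 1; push_cast; ring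
  have hl : HasDerivAt (fun u : ℝ => -(l * u / 2)) (-(l / 2)) u := by
    convert! (((hasDerivAt_id u).const_mul l).div_const 2).neg using 1; ring
  refine ⟨(besselCoeff_decay.hasDerivAt_powSum _).comp u hy, ?_⟩
  convert! ((besselCoeff_decay.derivCoeff.hasDerivAt_powSum _).comp u hy).mul hl using 1
  have h := besselCoeff_ode (-(l * u ^ 2 / 4))
  simp only [Function.comp_def]
  rw [← h]
  field_simp
  ring

lemma isBesselSolution_besselJ₀ : ∃ w', IsBesselSolution 1 besselJ₀ w' := by
  have h := isBesselSolution_powSum 1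
  simp only [one_mul, ← besselJ₀_eq] at h
  exact ⟨_, h⟩

lemma isBesselSolution_besselI₀ : ∃ w', IsBesselSolution (-1) besselI₀ w' := by
  have h := isBesselSolution_powSum (-1)
  simp only [neg_mul, one_mul, neg_div, neg_neg, ← besselI₀_eq] at h
  exact ⟨_, h⟩

lemma isBesselSolution_besselY₀ : ∃ w', IsBesselSolution 1 besselY₀ w' := by
  have hy (u : ℝ) : HasDerivAt (fun u : ℝ => -(u ^ 2 / 4)) (-(u / 2)) u := by
    convert! ((hasDerivAt_pow 2 u).div_const 4).neg using 1; push_cast; ring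
  refine ⟨fun u => 2 / Real.pi * (1 / u * powSum besselCoeff (-(u ^ 2 / 4))
    + (Real.log (u / 2) + Real.eulerMascheroniConstant)
      * (powSum (derivCoeff besselCoeff) (-(u ^ 2 / 4)) * (-(u / 2)))
    - powSum (derivCoeff harmonicCoeff) (-(u ^ 2 / 4)) * (-(u / 2))), fun u hu => ?_⟩
  have hlog : HasDerivAt (fun u => Real.log (u / 2) + Real.eulerMascheroniConstant) (1 / u) u := by
    convert! (((hasDerivAt_id u).div_const 2).log (by simpa using hu.ne')).add_const
      Real.eulerMascheroniConstant using 1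
    simp only [id]; field_simp
  have hh : HasDerivAt (fun u : ℝ => -(u / 2)) (-(1 / 2)) u := ((hasDerivAt_id u).div_const 2).neg
  have hE := (besselCoeff_decay.hasDerivAt_powSum _).comp u (hy u)
  have hE' := ((besselCoeff_decay.derivCoeff.hasDerivAt_powSum _).comp u (hy u)).mul hh
  have hG := (harmonicCoeff_decay.hasDerivAt_powSum _).comp u (hy u)
  have hG' := ((harmonicCoeff_decay.derivCoeff.hasDerivAt_powSum _).comp u (hy u)).mul hh
  have hinv : HasDerivAt (fun u : ℝ => 1 / u) (-(1 / u ^ 2)) u := by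
    simpa [one_div] using hasDerivAt_inv hu.ne'
  constructor
  · rw [show besselY₀ = _ from funext besselY₀_eq]
    exact ((hlog.mul hE).sub hG).const_mul _
  · rw [besselY₀_eq]
    convert! (((hinv.mul hE).add (hlog.mul hE')).sub hG').const_mul (2 / Real.pi) using 1
    have e1 := besselCoeff_ode (-(u ^ 2 / 4))
    have e2 := harmonicCoeff_ode (-(u ^ 2 / 4))
    simp only [Function.comp_def, Pi.mul_apply]
    generalize powSum besselCoeff (-(u ^ 2 / 4)) = E₀ at *
    generalize powSum harmonicCoeff (-(u ^ 2 / 4)) = G₀ at *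
    obtain rfl := eq_sub_of_add_eq e2.symm
    subst e1
    have := Real.pi_pos
    field_simp
    ring

/-! ### The Macdonald function -/

/-- The integrals `∫₀^∞ coshⁿ s exp (-x cosh s) ds`: up to sign, the `n`-th derivative of `K₀`. -/
noncomputable def coshMoment (n : ℕ) (x : ℝ) : ℝ :=
  ∫ s in Set.Ioi (0 : ℝ), Real.cosh s ^ n * Real.exp (-x * Real.cosh s)

lemma besselK₀_eq : besselK₀ = coshMoment 0 := by
  ext x; simp [besselK₀, coshMoment]

/-- Half of the exponent absorbs the power of `cosh s`, the other half decays at least like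
`exp (-(x / 2) s)`. -/
lemma cosh_pow_mul_exp_le (n : ℕ) {x s : ℝ} (hx : 0 < x) (hs : 0 ≤ s) :
    Real.cosh s ^ n * Real.exp (-x * Real.cosh s)
      ≤ n.factorial * (2 / x) ^ n * Real.exp (-(x / 2) * s) := by
  have hc : s ≤ Real.cosh s := (Real.self_le_sinh_iff.2 hs).trans (Real.sinh_lt_cosh s).le
  have h1 := Real.pow_div_factorial_le_exp (x / 2 * Real.cosh s)
    (by have := Real.cosh_pos s; positivity) n
  rw [div_le_iff₀ (by positivity), mul_pow] at h1
  have h2 : Real.cosh s ^ n ≤ n.factorial * (2 / x) ^ n * Real.exp (x / 2 * Real.cosh s) := by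
    calc Real.cosh s ^ n = (2 / x) ^ n * ((x / 2) ^ n * Real.cosh s ^ n) := by
          rw [← mul_assoc, ← mul_pow, div_mul_div_comm, mul_comm 2 x, div_self (by positivity)]
          simp
      _ ≤ (2 / x) ^ n * (Real.exp (x / 2 * Real.cosh s) * n.factorial) := by gcongr
      _ = _ := by ring
  calc _ ≤ n.factorial * (2 / x) ^ n * Real.exp (x / 2 * Real.cosh s)
        * Real.exp (-x * Real.cosh s) := by gcongr
    _ = n.factorial * (2 / x) ^ n * Real.exp (-(x / 2) * Real.cosh s) := by
      rw [mul_assoc, ← Real.exp_add]; ring_nf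
    _ ≤ _ := by
      gcongr _ * Real.exp ?_
      nlinarith

lemma integrableOn_cosh_pow_mul_exp (n : ℕ) {x : ℝ} (hx : 0 < x) :
    IntegrableOn (fun s => Real.cosh s ^ n * Real.exp (-x * Real.cosh s)) (Set.Ioi 0) := by
  refine Integrable.mono' ((exp_neg_integrableOn_Ioi 0 (half_pos hx)).const_mul
    (n.factorial * (2 / x) ^ n)) (Continuous.aestronglyMeasurable (by fun_prop)) ?_
  refine (ae_restrict_mem measurableSet_Ioi).mono fun s hs => ?_
  have := Real.cosh_pos s
  rw [Real.norm_of_nonneg (by positivity)]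
  exact cosh_pow_mul_exp_le n hx (le_of_lt hs)

lemma hasDerivAt_coshMoment (n : ℕ) {x : ℝ} (hx : 0 < x) :
    HasDerivAt (coshMoment n) (-coshMoment (n + 1) x) x := by
  have h := (hasDerivAt_integral_of_dominated_loc_of_deriv_le
    (μ := volume.restrict (Set.Ioi 0)) (x₀ := x) (s := Set.Ioi (x / 2))
    (F := fun x s => Real.cosh s ^ n * Real.exp (-x * Real.cosh s))
    (F' := fun x s => -(Real.cosh s ^ (n + 1) * Real.exp (-x * Real.cosh s)))
    (bound := fun s => Real.cosh s ^ (n + 1) * Real.exp (-(x / 2) * Real.cosh s))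
    (Ioi_mem_nhds (by linarith))
    (Eventually.of_forall fun y => Continuous.aestronglyMeasurable (by fun_prop))
    (integrableOn_cosh_pow_mul_exp n hx)
    (Continuous.aestronglyMeasurable (by fun_prop))
    (ae_of_all _ fun s y hy => ?_)
    (integrableOn_cosh_pow_mul_exp (n + 1) (half_pos hx))
    (ae_of_all _ fun s y _ => ?_)).2
  · rw [integral_neg] at h
    exact h
  · have := Real.cosh_pos s
    rw [norm_neg, Real.norm_of_nonneg (by positivity)]
    have hy' : x / 2 < y := hy
    gcongr
  · convert! ((((hasDerivAt_id y).neg.mul_const (Real.cosh s)).exp).const_mul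
      (Real.cosh s ^ n)) using 1
    simp only [id, Pi.neg_apply]; ring

/-- The integrand of `x K₀'' + K₀' - x K₀` is the derivative of `-sinh s * exp (-x cosh s)`, which
vanishes at both ends. -/
lemma coshMoment_two {x : ℝ} (hx : 0 < x) :
    coshMoment 2 x = coshMoment 1 x / x + coshMoment 0 x := by
  have hd (s : ℝ) : HasDerivAt (fun s => -(Real.sinh s * Real.exp (-x * Real.cosh s)))
      (x * (Real.cosh s ^ 2 * Real.exp (-x * Real.cosh s))
        - Real.cosh s ^ 1 * Real.exp (-x * Real.cosh s)
        - x * (Real.cosh s ^ 0 * Real.exp (-x * Real.cosh s))) s := by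
    convert! ((Real.hasDerivAt_sinh s).mul ((Real.hasDerivAt_cosh s).const_mul (-x)).exp).neg
      using 1
    have := Real.cosh_sq s
    linear_combination x * Real.exp (-x * Real.cosh s) * this
  have i0 := integrableOn_cosh_pow_mul_exp 0 hx
  have i1 := integrableOn_cosh_pow_mul_exp 1 hx
  have i2 := integrableOn_cosh_pow_mul_exp 2 hx
  have hlim : Tendsto (fun s => -(Real.sinh s * Real.exp (-x * Real.cosh s))) atTop (𝓝 0) := by
    have hb : Tendsto (fun s => (Nat.factorial 1 : ℝ) * (2 / x) ^ 1 * Real.exp (-(x / 2) * s))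
        atTop (𝓝 0) := by
      have : Tendsto (fun s => -(x / 2) * s) atTop atBot :=
        tendsto_id.const_mul_atTop_of_neg (by linarith)
      simpa only [mul_zero, Function.comp_def] using
        (Real.tendsto_exp_atBot.comp this).const_mul ((Nat.factorial 1 : ℝ) * (2 / x) ^ 1)
    refine squeeze_zero_norm' ?_ hb
    filter_upwards [eventually_ge_atTop 0] with s hs
    refine le_trans ?_ (cosh_pow_mul_exp_le 1 hx hs)
    have h0 := Real.sinh_nonneg_iff.2 hs
    rw [norm_neg, Real.norm_of_nonneg (by positivity), pow_one]
    have := (Real.sinh_lt_cosh s).le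
    gcongr
  have h := integral_Ioi_of_hasDerivAt_of_tendsto' (a := 0) (fun s _ => hd s)
    (((i2.const_mul x).sub i1).sub (i0.const_mul x)) hlim
  have i21 : IntegrableOn (fun s => x * (Real.cosh s ^ 2 * Real.exp (-x * Real.cosh s))
      - Real.cosh s ^ 1 * Real.exp (-x * Real.cosh s)) (Set.Ioi 0) := (i2.const_mul x).sub i1
  rw [integral_sub i21 (i0.const_mul x), integral_sub (i2.const_mul x) i1,
    integral_const_mul, integral_const_mul] at h
  simp only [Real.sinh_zero, zero_mul, neg_zero, sub_zero] at h
  change x * coshMoment 2 x - coshMoment 1 x - x * coshMoment 0 x = 0 at h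
  field_simp
  linarith

lemma isBesselSolution_besselK₀ : ∃ w', IsBesselSolution (-1) besselK₀ w' := by
  refine ⟨fun x => -coshMoment 1 x, fun x hx => ?_⟩
  rw [besselK₀_eq]
  refine ⟨hasDerivAt_coshMoment 0 hx, ?_⟩
  convert! (hasDerivAt_coshMoment 1 hx).neg using 1
  rw [show 1 + 1 = 2 from rfl, coshMoment_two hx]; ring

lemma not_boundedNearAxis_besselK₀ : ¬ BoundedNearAxis besselK₀ := by
  rintro ⟨ε, hε, B, hB⟩
  -- `T exp (-x cosh T) ≤ K₀ x` for every `T`; the left side tends to `T` as `x` tends to `0`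
  set T := |B| + 1 with hT
  have hT0 : 0 < T := by positivity
  have key (x : ℝ) (hx : 0 < x) : T * Real.exp (-x * Real.cosh T) ≤ besselK₀ x := by
    have hi := integrableOn_cosh_pow_mul_exp 0 hx
    simp only [pow_zero, one_mul] at hi
    calc T * Real.exp (-x * Real.cosh T)
        = ∫ _ in Set.Ioc 0 T, Real.exp (-x * Real.cosh T) := by
          simp [hT0.le]
      _ ≤ ∫ s in Set.Ioc 0 T, Real.exp (-x * Real.cosh s) := by
          refine setIntegral_mono_on (by simp) (hi.mono_set Set.Ioc_subset_Ioi_self)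
            measurableSet_Ioc fun s hs => Real.exp_le_exp.2 ?_
          have : Real.cosh s ≤ Real.cosh T :=
            Real.cosh_le_cosh.2 (by rw [abs_of_pos hs.1, abs_of_pos hT0]; exact hs.2)
          nlinarith
      _ ≤ _ := setIntegral_mono_set hi (ae_of_all _ fun s => (Real.exp_pos _).le)
          Set.Ioc_subset_Ioi_self.eventuallyLE
  have hlim : Tendsto (fun x => T * Real.exp (-x * Real.cosh T)) (𝓝[>] 0) (𝓝 T) := by
    have : Continuous fun x => T * Real.exp (-x * Real.cosh T) := by fun_prop
    simpa using (this.tendsto 0).mono_left nhdsWithin_le_nhds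
  have hle : T ≤ B := by
    refine le_of_tendsto hlim ?_
    filter_upwards [Ioo_mem_nhdsGT hε] with x hx
    exact (key x hx.1).trans ((le_abs_self _).trans (hB x hx.1 hx.2))
  linarith [le_abs_self B]

lemma boundedAtInfinity_besselK₀ : BoundedAtInfinity besselK₀ := by
  refine ⟨1, besselK₀ 1, fun x hx h1 => ?_⟩
  have hi (y : ℝ) (hy : 0 < y) := integrableOn_cosh_pow_mul_exp 0 hy
  simp only [pow_zero, one_mul] at hi
  rw [besselK₀, abs_of_nonneg (integral_nonneg fun s => (Real.exp_pos _).le)]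
  refine integral_mono (hi x hx) (hi 1 one_pos) fun s => Real.exp_le_exp.2 ?_
  have := Real.cosh_pos s
  nlinarith

/-! ### Behaviour of the Bessel functions at zero and at infinity -/

lemma tendsto_powSum_zero {a : ℕ → ℝ} (ha : FactorialDecay a) (l : ℝ) :
    Tendsto (fun u : ℝ => powSum a (l * u ^ 2)) (𝓝[>] 0) (𝓝 (a 0)) := by
  have h0 : powSum a 0 = a 0 := by
    rw [powSum, tsum_eq_single 0 (fun k hk => by simp [hk])]; simp
  have hc : Continuous (powSum a) :=
    continuous_iff_continuousAt.2 fun y => (ha.hasDerivAt_powSum y).continuousAt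
  have : Continuous fun u : ℝ => powSum a (l * u ^ 2) := by fun_prop
  simpa [h0] using (this.tendsto 0).mono_left nhdsWithin_le_nhds

lemma tendsto_besselI₀_zero : Tendsto besselI₀ (𝓝[>] 0) (𝓝 1) := by
  have h := tendsto_powSum_zero besselCoeff_decay (1 / 4)
  simp only [besselCoeff, Nat.factorial_zero, Nat.cast_one, one_pow, div_one] at h
  refine h.congr fun u => ?_
  rw [besselI₀_eq]; congr 1; ring

lemma tendsto_besselJ₀_zero : Tendsto besselJ₀ (𝓝[>] 0) (𝓝 1) := by
  have h := tendsto_powSum_zero besselCoeff_decay (-1 / 4)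
  simp only [besselCoeff, Nat.factorial_zero, Nat.cast_one, one_pow, div_one] at h
  refine h.congr fun u => ?_
  rw [besselJ₀_eq]; congr 1; ring

lemma not_boundedNearAxis_besselY₀ : ¬ BoundedNearAxis besselY₀ := by
  rintro ⟨ε, hε, B, hB⟩
  have hG : Tendsto (fun u : ℝ => powSum harmonicCoeff (-(u ^ 2 / 4))) (𝓝[>] 0)
      (𝓝 (harmonicCoeff 0)) :=
    (tendsto_powSum_zero harmonicCoeff_decay (-1 / 4)).congr fun u => by congr 1; ring
  have hJ := tendsto_besselJ₀_zero
  have hlog : Tendsto (fun u : ℝ => Real.log (u / 2) + Real.eulerMascheroniConstant)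
      (𝓝[>] 0) atBot := by
    refine tendsto_atBot_add_const_right _ _ ?_
    have : Tendsto (fun u : ℝ => Real.log u - Real.log 2) (𝓝[>] 0) atBot :=
      tendsto_atBot_add_const_right _ _ Real.tendsto_log_nhdsGT_zero
    refine this.congr' ?_
    filter_upwards [self_mem_nhdsWithin] with u hu
    rw [Real.log_div (ne_of_gt hu) two_ne_zero]
  have h1 : Tendsto besselY₀ (𝓝[>] 0) atBot := by
    have := ((hlog.atBot_mul_pos one_pos hJ).atBot_add hG.neg).const_mul_atBot
      (show 0 < 2 / Real.pi by have := Real.pi_pos; positivity)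
    refine this.congr fun u => ?_
    rw [besselY₀_eq, besselJ₀_eq]; ring
  obtain ⟨u, hu, hu'⟩ := ((h1.eventually_lt_atBot (-B)).and (Ioo_mem_nhdsGT hε)).exists
  have := (neg_abs_le (besselY₀ u)).trans hu.le
  have := hB u hu'.1 hu'.2
  linarith [neg_abs_le (besselY₀ u)]

/-- The quadratic term of the series bounds `I₀` from below. -/
lemma le_besselI₀ (x : ℝ) : x ^ 2 / 4 ≤ besselI₀ x := by
  have h := (besselCoeff_decay.summable (x ^ 2 / 4)).le_tsum 1
    (fun k _ => by rw [besselCoeff]; positivity)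
  rw [besselI₀_eq]
  simpa [besselCoeff, powSum] using h

lemma not_boundedAtInfinity_besselI₀ : ¬ BoundedAtInfinity besselI₀ := by
  rintro ⟨R, B, hB⟩
  have h1 : 0 < |R| + |B| + 4 := by positivity
  have h := hB (|R| + |B| + 4) h1 (by linarith [le_abs_self R, abs_nonneg B])
  have h2 := (le_besselI₀ (|R| + |B| + 4)).trans ((le_abs_self _).trans h)
  nlinarith [le_abs_self B, abs_nonneg R, abs_nonneg B]

/-! ### Geometry of helicoidal surfaces -/

section Geometry

variable {z : ℝ → ℝ} {c : ℝ}

lemma pd₁_helicoidal {u : ℝ} (hz : DifferentiableAt ℝ z u) (t : ℝ) :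
    pd₁ (helicoidal z c) u t = ![Real.cos t, Real.sin t, deriv z u] := by
  refine HasDerivAt.deriv (hasDerivAt_pi.2 fun i => ?_)
  fin_cases i
  · simpa [helicoidal] using (hasDerivAt_id u).mul_const (Real.cos t)
  · simpa [helicoidal] using (hasDerivAt_id u).mul_const (Real.sin t)
  · simpa [helicoidal] using hz.hasDerivAt

lemma pd₂_helicoidal (u t : ℝ) :
    pd₂ (helicoidal z c) u t = ![-(u * Real.sin t), u * Real.cos t, c] := by
  refine HasDerivAt.deriv (hasDerivAt_pi.2 fun i => ?_)
  fin_cases i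
  · simpa [helicoidal] using (Real.hasDerivAt_cos t).const_mul u
  · simpa [helicoidal] using (Real.hasDerivAt_sin t).const_mul u
  · simpa [helicoidal] using ((hasDerivAt_id t).const_mul c).const_add (z u)

lemma g₁₁_helicoidal {u : ℝ} (hz : DifferentiableAt ℝ z u) (t : ℝ) :
    g₁₁ (helicoidal z c) u t = 1 := by
  simp only [g₁₁, isoInner, pd₁_helicoidal hz, Matrix.cons_val_zero, Matrix.cons_val_one]
  linear_combination Real.sin_sq_add_cos_sq t

lemma g₁₂_helicoidal {u : ℝ} (hz : DifferentiableAt ℝ z u) (t : ℝ) :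
    g₁₂ (helicoidal z c) u t = 0 := by
  simp only [g₁₂, isoInner, pd₁_helicoidal hz, pd₂_helicoidal, Matrix.cons_val_zero,
    Matrix.cons_val_one]
  ring

lemma g₂₂_helicoidal (u t : ℝ) : g₂₂ (helicoidal z c) u t = u ^ 2 := by
  simp only [g₂₂, isoInner, pd₂_helicoidal, Matrix.cons_val_zero, Matrix.cons_val_one]
  linear_combination u ^ 2 * Real.sin_sq_add_cos_sq t

lemma sqrtDet_helicoidal {u : ℝ} (hu : 0 < u) (hz : DifferentiableAt ℝ z u) (t : ℝ) :
    sqrtDet (helicoidal z c) u t = u := by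
  simp [sqrtDet, g₁₁_helicoidal hz, g₁₂_helicoidal hz, g₂₂_helicoidal, Real.sqrt_sq hu.le]

lemma minimalNormal_helicoidal {u : ℝ} (hu : 0 < u) (hz : DifferentiableAt ℝ z u) (t : ℝ) :
    minimalNormal (helicoidal z c) u t = ![c / u * Real.sin t - deriv z u * Real.cos t,
      -(deriv z u * Real.sin t) - c / u * Real.cos t, 1] := by
  have hm : minor₁₂ (helicoidal z c) u t = u := by
    simp only [minor₁₂, pd₁_helicoidal hz, pd₂_helicoidal, Matrix.cons_val_zero,
      Matrix.cons_val_one]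
    linear_combination u * Real.sin_sq_add_cos_sq t
  have hs := Real.sin_sq_add_cos_sq t
  rw [minimalNormal, hm, pd₁_helicoidal hz, pd₂_helicoidal, cross_apply]
  ext i
  fin_cases i
  · simp; field_simp
  · simp; field_simp
  · simp; field_simp; linear_combination hs

/-- In the coordinates `(u, t)` the induced metric is the flat metric `du² + u² dt²`, so that the
Laplace-Beltrami operator is the planar Laplacian in polar coordinates. -/
lemma laplaceBeltrami_helicoidal (hz : ∀ u, 0 < u → DifferentiableAt ℝ z u)
    {f F F₁ F₁₁ F₂ F₂₂ : ℝ → ℝ → ℝ} (hf : ∀ u, 0 < u → ∀ t, f u t = F u t)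
    (h₁ : ∀ u, 0 < u → ∀ t, HasDerivAt (fun s => F s t) (F₁ u t) u)
    (h₁₁ : ∀ u, 0 < u → ∀ t, HasDerivAt (fun s => F₁ s t) (F₁₁ u t) u)
    (h₂ : ∀ u, 0 < u → ∀ t, HasDerivAt (fun s => F u s) (F₂ u t) t)
    (h₂₂ : ∀ u, 0 < u → ∀ t, HasDerivAt (fun s => F₂ u s) (F₂₂ u t) t)
    {u : ℝ} (hu : 0 < u) (t : ℝ) :
    laplaceBeltrami (helicoidal z c) f u t = F₁₁ u t + F₁ u t / u + F₂₂ u t / u ^ 2 := by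
  have e₁ (u : ℝ) (hu : 0 < u) (t : ℝ) : pd₁ f u t = F₁ u t :=
    ((h₁ u hu t).congr_of_eventuallyEq
      ((eventually_gt_nhds hu).mono fun s hs => hf s hs t)).deriv
  have e₂ (t : ℝ) : pd₂ f u t = F₂ u t := by
    rw [pd₂, show (fun s => f u s) = fun s => F u s from funext fun s => hf u hu s]
    exact (h₂ u hu t).deriv
  have d₁ : pd₁ (fun u t => (g₂₂ (helicoidal z c) u t * pd₁ f u t
      - g₁₂ (helicoidal z c) u t * pd₂ f u t) / sqrtDet (helicoidal z c) u t) u t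
      = F₁ u t + u * F₁₁ u t := by
    have hd : HasDerivAt (fun s => s * F₁ s t) (F₁ u t + u * F₁₁ u t) u := by
      simpa using (hasDerivAt_id u).fun_mul (h₁₁ u hu t)
    refine (hd.congr_of_eventuallyEq ?_).deriv
    filter_upwards [eventually_gt_nhds hu] with s hs
    rw [g₂₂_helicoidal, g₁₂_helicoidal (hz s hs), sqrtDet_helicoidal hs (hz s hs), e₁ s hs]
    field_simp
    ring
  have d₂ : pd₂ (fun u t => (g₁₁ (helicoidal z c) u t * pd₂ f u t
      - g₁₂ (helicoidal z c) u t * pd₁ f u t) / sqrtDet (helicoidal z c) u t) u t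
      = F₂₂ u t / u := by
    simp only [pd₂]
    simp only [g₁₁_helicoidal (hz u hu), g₁₂_helicoidal (hz u hu), sqrtDet_helicoidal hu (hz u hu),
      zero_mul, sub_zero, one_mul]
    change deriv (fun s => pd₂ f u s / u) t = _
    simp only [e₂]
    exact ((h₂₂ u hu t).div_const u).deriv
  rw [laplaceBeltrami, d₁, d₂, sqrtDet_helicoidal hu (hz u hu)]
  field_simp
  ring

/-- The Laplacian of a function of the form `a(u) cos t + (b / u) sin t`, the shape common to the
first two coordinates of the minimal normal; the second summand is harmonic. -/
lemma laplaceBeltrami_helicoidal_of_eq (hz : ∀ u, 0 < u → DifferentiableAt ℝ z u)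
    {a a₁ a₂ p q p' q' : ℝ → ℝ} {b : ℝ} {f : ℝ → ℝ → ℝ}
    (ha : ∀ u, 0 < u → HasDerivAt a (a₁ u) u) (ha₁ : ∀ u, 0 < u → HasDerivAt a₁ (a₂ u) u)
    (hp : ∀ t, HasDerivAt p (p' t) t) (hp' : ∀ t, HasDerivAt p' (-p t) t)
    (hq : ∀ t, HasDerivAt q (q' t) t) (hq' : ∀ t, HasDerivAt q' (-q t) t)
    (hf : ∀ u, 0 < u → ∀ t, f u t = a u * p t + b / u * q t) {u : ℝ} (hu : 0 < u) (t : ℝ) :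
    laplaceBeltrami (helicoidal z c) f u t = (a₂ u + a₁ u / u - a u / u ^ 2) * p t := by
  have hb (u : ℝ) (hu : 0 < u) : HasDerivAt (fun u => b / u) (-b / u ^ 2) u := by
    convert! (hasDerivAt_inv hu.ne').const_mul b using 1; ring
  have hb' (u : ℝ) (hu : 0 < u) : HasDerivAt (fun u => -b / u ^ 2) (2 * b / u ^ 3) u := by
    convert! ((hasDerivAt_pow 2 u).inv (by positivity)).const_mul (-b) using 1
    push_cast; field_simp
  rw [laplaceBeltrami_helicoidal hz
    (F := fun u t => a u * p t + b / u * q t)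
    (F₁ := fun u t => a₁ u * p t + -b / u ^ 2 * q t)
    (F₁₁ := fun u t => a₂ u * p t + 2 * b / u ^ 3 * q t)
    (F₂ := fun u t => a u * p' t + b / u * q' t)
    (F₂₂ := fun u t => a u * -p t + b / u * -q t) hf
    (fun u hu t => ((ha u hu).mul_const _).add ((hb u hu).mul_const _))
    (fun u hu t => ((ha₁ u hu).mul_const _).add ((hb' u hu).mul_const _))
    (fun u hu t => ((hp t).const_mul _).add ((hq t).const_mul _))
    (fun u hu t => ((hp' t).const_mul _).add ((hq' t).const_mul _)) hu t]
  field_simp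
  ring

/-- The first two coordinates of the finite type condition as a system for the generating curve.
Comparing the coefficients of `cos t` and `sin t` in each coordinate gives the third-order equation
for `z` and the vanishing of `lᵢ * c`. -/
lemma FiniteTypeMinimalNormal.generatingCurve {l₁ l₂ l₃ : ℝ}
    (hz : ContDiffOn ℝ 3 z (Set.Ioi 0))
    (hM : FiniteTypeMinimalNormal (helicoidal z c) helicoidalDomain ![l₁, l₂, l₃]) :
    l₁ * c = 0 ∧ l₂ * c = 0 ∧ ∃ z₁ z₂ z₃ : ℝ → ℝ, ∀ u, 0 < u →
      HasDerivAt z (z₁ u) u ∧ HasDerivAt z₁ (z₂ u) u ∧ HasDerivAt z₂ (z₃ u) u ∧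
      z₃ u + z₂ u / u - z₁ u / u ^ 2 = -l₁ * z₁ u ∧
      z₃ u + z₂ u / u - z₁ u / u ^ 2 = -l₂ * z₁ u := by
  rw [show (3 : WithTop ℕ∞) = 2 + 1 from rfl, contDiffOn_succ_iff_deriv_of_isOpen isOpen_Ioi,
    show (2 : WithTop ℕ∞) = 1 + 1 from rfl, contDiffOn_succ_iff_deriv_of_isOpen isOpen_Ioi] at hz
  obtain ⟨d0, -, d1, -, hz2⟩ := hz
  have d2 := hz2.differentiableOn one_ne_zero
  have D {f : ℝ → ℝ} (hf : DifferentiableOn ℝ f (Set.Ioi 0)) (u : ℝ) (hu : 0 < u) :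
      HasDerivAt f (deriv f u) u := (hf.differentiableAt (Ioi_mem_nhds hu)).hasDerivAt
  have hd (u : ℝ) (hu : 0 < u) : DifferentiableAt ℝ z u := (D d0 u hu).differentiableAt
  have hns (t : ℝ) : HasDerivAt (fun t => -Real.sin t) (-Real.cos t) t :=
    (Real.hasDerivAt_sin t).neg
  have hnc (t : ℝ) : HasDerivAt (fun t => -Real.cos t) (Real.sin t) t := by
    simpa using (Real.hasDerivAt_cos t).fun_neg
  have hs (t : ℝ) : HasDerivAt Real.sin (- -Real.cos t) t := by
    simpa using Real.hasDerivAt_sin t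
  have hc (t : ℝ) : HasDerivAt (fun t => -Real.cos t) (- -Real.sin t) t := by
    simpa using hnc t
  have E₁ (u : ℝ) (hu : 0 < u) (t : ℝ) :
      -((deriv (deriv (deriv z)) u + deriv (deriv z) u / u - deriv z u / u ^ 2) * -Real.cos t)
        = l₁ * (c / u * Real.sin t - deriv z u * Real.cos t) := by
    have h := hM (u, t) hu 0
    rw [laplaceBeltrami_helicoidal_of_eq (b := c) hd (D d1) (D d2) hnc hs
      Real.hasDerivAt_sin Real.hasDerivAt_cos (fun u hu t => by
        simp only [minimalNormal_helicoidal hu (hd u hu), Matrix.cons_val_zero]; ring) hu,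
      minimalNormal_helicoidal hu (hd u hu)] at h
    simpa only [Matrix.cons_val_zero] using h
  have E₂ (u : ℝ) (hu : 0 < u) (t : ℝ) :
      -((deriv (deriv (deriv z)) u + deriv (deriv z) u / u - deriv z u / u ^ 2) * -Real.sin t)
        = l₂ * (-(deriv z u * Real.sin t) - c / u * Real.cos t) := by
    have h := hM (u, t) hu 1
    rw [laplaceBeltrami_helicoidal_of_eq (b := c) hd (D d1) (D d2) hns hc
      hnc hs (fun u hu t => by
        simp only [minimalNormal_helicoidal hu (hd u hu), Matrix.cons_val_one, Matrix.cons_val_zero]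
        ring) hu,
      minimalNormal_helicoidal hu (hd u hu)] at h
    simpa only [Matrix.cons_val_zero, Matrix.cons_val_one] using h
  -- at `t = 0` and `t = π / 2` the coefficients of `cos t` and `sin t` can be read off
  refine ⟨?_, ?_, deriv z, deriv (deriv z), deriv (deriv (deriv z)), fun u hu =>
    ⟨D d0 u hu, D d1 u hu, D d2 u hu, ?_, ?_⟩⟩
  · have := E₁ 1 one_pos (Real.pi / 2)
    simp at this
    simpa using this
  · have := E₂ 1 one_pos 0
    simp at this
    simpa using this
  · have := E₁ u hu 0
    simp at this
    linarith
  · have := E₂ u hu (Real.pi / 2)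
    simp at this
    linarith

end Geometry

/-! ### Wronskians -/

lemma exists_eq_of_hasDerivAt_zero {s : Set ℝ} (hs : IsOpen s) (hs' : IsPreconnected s)
    {f : ℝ → ℝ} (hf : ∀ u ∈ s, HasDerivAt f 0 u) : ∃ k, ∀ u ∈ s, f u = k :=
  hs.exists_is_const_of_deriv_eq_zero hs'
    (fun u hu => (hf u hu).differentiableAt.differentiableWithinAt) fun u hu => (hf u hu).deriv

/-- Abel's identity: `u` times the Wronskian of two solutions is constant. -/
lemma IsBesselSolution.wronskian {l : ℝ} {w w' v v' : ℝ → ℝ} (hw : IsBesselSolution l w w')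
    (hv : IsBesselSolution l v v') : ∃ k, ∀ u, 0 < u → u * (w u * v' u - w' u * v u) = k := by
  refine exists_eq_of_hasDerivAt_zero isOpen_Ioi isPreconnected_Ioi fun u hu => ?_
  have hu' : 0 < u := hu
  obtain ⟨a1, a2⟩ := hw u hu
  obtain ⟨b1, b2⟩ := hv u hu
  convert! (hasDerivAt_id u).mul ((a1.mul b2).sub (a2.mul b1)) using 1
  simp only [id, Pi.sub_apply, Pi.mul_apply]
  field_simp
  ring

/-! ### Bounded functions on the half-line -/

lemma BoundedNearAxis.of_eq {f g k : ℝ → ℝ} (hf : BoundedNearAxis f) (hg : BoundedNearAxis g)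
    (a b : ℝ) (h : ∀ u, 0 < u → k u = a * f u + b * g u) : BoundedNearAxis k := by
  obtain ⟨ε, hε, A, hA⟩ := hf
  obtain ⟨δ, hδ, B, hB⟩ := hg
  refine ⟨min ε δ, lt_min hε hδ, |a| * A + |b| * B, fun u hu hu' => ?_⟩
  have h1 := hA u hu (hu'.trans_le (min_le_left _ _))
  have h2 := hB u hu (hu'.trans_le (min_le_right _ _))
  rw [h u hu]
  refine (abs_add_le _ _).trans ?_
  rw [abs_mul, abs_mul]
  gcongr

lemma BoundedAtInfinity.of_eq {f g k : ℝ → ℝ} (hf : BoundedAtInfinity f)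
    (hg : BoundedAtInfinity g)
    (a b : ℝ) (h : ∀ u, 0 < u → k u = a * f u + b * g u) : BoundedAtInfinity k := by
  obtain ⟨R, A, hA⟩ := hf
  obtain ⟨S, B, hB⟩ := hg
  refine ⟨max R S, |a| * A + |b| * B, fun u hu hu' => ?_⟩
  have h1 := hA u hu ((le_max_left _ _).trans_lt hu')
  have h2 := hB u hu ((le_max_right _ _).trans_lt hu')
  rw [h u hu]
  refine (abs_add_le _ _).trans ?_
  rw [abs_mul, abs_mul]
  gcongr

lemma boundedNearAxis_const (k : ℝ) : BoundedNearAxis fun _ => k :=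
  ⟨1, one_pos, |k|, fun _ _ _ => le_rfl⟩

lemma boundedAtInfinity_const (k : ℝ) : BoundedAtInfinity fun _ => k :=
  ⟨1, |k|, fun _ _ _ => le_rfl⟩

lemma boundedNearAxis_comp_mul_iff {f : ℝ → ℝ} {a : ℝ} (ha : 0 < a) :
    BoundedNearAxis (fun u => f (a * u)) ↔ BoundedNearAxis f := by
  constructor
  · rintro ⟨ε, hε, B, hB⟩
    refine ⟨a * ε, by positivity, B, fun u hu hu' => ?_⟩
    have : |f (a * (u / a))| ≤ B := hB (u / a) (by positivity) (by rwa [div_lt_iff₀' ha])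
    rwa [show a * (u / a) = u by field_simp] at this
  · rintro ⟨ε, hε, B, hB⟩
    exact ⟨ε / a, by positivity, B, fun u hu hu' =>
      hB _ (by positivity) (by rwa [lt_div_iff₀' ha] at hu')⟩

lemma boundedAtInfinity_comp_mul_iff {f : ℝ → ℝ} {a : ℝ} (ha : 0 < a) :
    BoundedAtInfinity (fun u => f (a * u)) ↔ BoundedAtInfinity f := by
  constructor
  · rintro ⟨R, B, hB⟩
    refine ⟨a * R, B, fun u hu hu' => ?_⟩
    have : |f (a * (u / a))| ≤ B := hB (u / a) (by positivity) (by rwa [lt_div_iff₀' ha])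
    rwa [show a * (u / a) = u by field_simp] at this
  · rintro ⟨R, B, hB⟩
    exact ⟨R / a, B, fun u hu hu' => hB _ (by positivity) (by rwa [div_lt_iff₀' ha] at hu')⟩

lemma BoundedNearAxis.of_tendsto {f : ℝ → ℝ} {m : ℝ} (h : Tendsto f (𝓝[>] 0) (𝓝 m)) :
    BoundedNearAxis f := by
  have h' := h.abs.eventually_le_const (lt_add_one |m|)
  obtain ⟨ε, hε, H⟩ := mem_nhdsGT_iff_exists_Ioo_subset.1 h'
  exact ⟨ε, hε, |m| + 1, fun u hu hu' => H ⟨hu, hu'⟩⟩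

/-! ### The general solution of Bessel's equation -/

/-- If the Wronskian of `v₁`, `v₂` vanished, `v₂ / v₁` would be constant near `0`, where `v₁` has no
zero, contrary to `v₂` being unbounded there. The coefficients are quotients of Wronskians. -/
lemma IsBesselSolution.eq_combination {l : ℝ} {v₁ v₁' v₂ v₂' w w' : ℝ → ℝ}
    (h₁ : IsBesselSolution l v₁ v₁') (h₂ : IsBesselSolution l v₂ v₂')
    (hlim : Tendsto v₁ (𝓝[>] 0) (𝓝 1)) (hunb : ¬ BoundedNearAxis v₂)
    (hw : IsBesselSolution l w w') : ∃ A B, ∀ u, 0 < u → w u = A * v₁ u + B * v₂ u := by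
  -- `k`, `a`, `b` are the constants `u W(v₁, v₂)`, `u W(w, v₂)`, `u W(v₁, w)`
  obtain ⟨k, hk⟩ := h₁.wronskian h₂
  obtain ⟨a, ha⟩ := hw.wronskian h₂
  obtain ⟨b, hb⟩ := h₁.wronskian hw
  have hk0 : k ≠ 0 := by
    rintro rfl
    obtain ⟨ε, hε, H⟩ := mem_nhdsGT_iff_exists_Ioo_subset.1
      (hlim.eventually_const_lt one_pos)
    obtain ⟨q, hq⟩ := exists_eq_of_hasDerivAt_zero (s := Set.Ioo 0 ε) isOpen_Ioo
      isPreconnected_Ioo (f := fun u => v₂ u / v₁ u) fun u hu => by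
        have hv : 0 < v₁ u := H hu
        convert! (h₂ u hu.1).1.div (h₁ u hu.1).1 hv.ne' using 1
        have := (mul_eq_zero.1 (hk u hu.1)).resolve_left hu.1.ne'
        rw [eq_comm, div_eq_zero_iff]
        left; linarith
    obtain ⟨δ, hδ, B, hB⟩ := BoundedNearAxis.of_tendsto hlim
    refine hunb ⟨min ε δ, lt_min hε hδ, |q| * B, fun u hu hu' => ?_⟩
    have hv : 0 < v₁ u := H ⟨hu, hu'.trans_le (min_le_left _ _)⟩
    have h3 : v₂ u / v₁ u = q := hq u ⟨hu, hu'.trans_le (min_le_left _ _)⟩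
    rw [div_eq_iff hv.ne'] at h3
    rw [h3, abs_mul]
    gcongr
    exact hB u hu (hu'.trans_le (min_le_right _ _))
  refine ⟨a / k, b / k, fun u hu => ?_⟩
  field_simp
  rw [← ha u hu, ← hb u hu, ← hk u hu]
  ring

lemma tendsto_comp_mul_zero {f : ℝ → ℝ} {m a : ℝ} (ha : 0 < a)
    (h : Tendsto f (𝓝[>] 0) (𝓝 m)) : Tendsto (fun u => f (a * u)) (𝓝[>] 0) (𝓝 m) := by
  refine h.comp (tendsto_nhdsWithin_iff.2 ⟨?_, ?_⟩)
  · have : Continuous fun u => a * u := by fun_prop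
    simpa using (this.tendsto 0).mono_left nhdsWithin_le_nhds
  · filter_upwards [self_mem_nhdsWithin] with u hu
    exact mul_pos ha hu

/-- Transfer of a fundamental system of the equation with parameter `m` to the parameter `l` by
rescaling the variable. -/
lemma IsBesselSolution.eq_combination_comp_mul {m l a : ℝ} (ha : 0 < a) (hl : l = m * a ^ 2)
    {v₁ v₂ w w' : ℝ → ℝ} (h₁ : ∃ v₁', IsBesselSolution m v₁ v₁')
    (h₂ : ∃ v₂', IsBesselSolution m v₂ v₂')
    (hlim : Tendsto v₁ (𝓝[>] 0) (𝓝 1)) (hunb : ¬ BoundedNearAxis v₂)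
    (hw : IsBesselSolution l w w') :
    ∃ A B, ∀ u, 0 < u → w u = A * v₁ (a * u) + B * v₂ (a * u) := by
  subst hl
  obtain ⟨v₁', h₁⟩ := h₁
  obtain ⟨v₂', h₂⟩ := h₂
  exact (h₁.comp_mul ha).eq_combination (h₂.comp_mul ha) (tendsto_comp_mul_zero ha hlim)
    (by rwa [boundedNearAxis_comp_mul_iff ha]) hw

lemma eq_zero_of_boundedNearAxis {z v₁ v₂ : ℝ → ℝ} {a z₀ A B : ℝ} (ha : 0 < a)
    (hlim : Tendsto v₁ (𝓝[>] 0) (𝓝 1)) (hunb : ¬ BoundedNearAxis v₂)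
    (h : ∀ u, 0 < u → z u = z₀ + A * v₁ (a * u) + B * v₂ (a * u)) (hz : BoundedNearAxis z) :
    B = 0 := by
  by_contra hB
  refine hunb ((boundedNearAxis_comp_mul_iff ha).1 ?_)
  have h1 := BoundedNearAxis.of_tendsto (tendsto_comp_mul_zero ha hlim)
  have h2 : BoundedNearAxis fun u => z u - z₀ :=
    hz.of_eq (boundedNearAxis_const z₀) 1 (-1) fun u _ => by ring
  refine h2.of_eq h1 (1 / B) (-A / B) fun u hu => ?_
  rw [h u hu]; field_simp; ring

lemma eq_zero_of_boundedAtInfinity {z v₁ v₂ : ℝ → ℝ} {a z₀ A B : ℝ} (ha : 0 < a)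
    (hbdd : BoundedAtInfinity v₂) (hunb : ¬ BoundedAtInfinity v₁)
    (h : ∀ u, 0 < u → z u = z₀ + A * v₁ (a * u) + B * v₂ (a * u)) (hz : BoundedAtInfinity z) :
    A = 0 := by
  by_contra hA
  refine hunb ((boundedAtInfinity_comp_mul_iff ha).1 ?_)
  have h2 : BoundedAtInfinity fun u => z u - z₀ :=
    hz.of_eq (boundedAtInfinity_const z₀) 1 (-1) fun u _ => by ring
  refine h2.of_eq ((boundedAtInfinity_comp_mul_iff ha).2 hbdd) (1 / A) (-B / A) fun u hu => ?_
  rw [h u hu]; field_simp; ring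

/-! ### The generating curve -/

/-- A first integral of `(z'' + z'/u)' = -l z'` on the half-line. -/
lemma exists_first_integral {l : ℝ} {z z₁ z₂ z₃ : ℝ → ℝ}
    (h : ∀ u, 0 < u → HasDerivAt z (z₁ u) u ∧ HasDerivAt z₁ (z₂ u) u ∧ HasDerivAt z₂ (z₃ u) u ∧
      z₃ u + z₂ u / u - z₁ u / u ^ 2 = -l * z₁ u) :
    ∃ k, ∀ u, 0 < u → z₂ u + z₁ u / u + l * z u = k := by
  refine exists_eq_of_hasDerivAt_zero isOpen_Ioi isPreconnected_Ioi fun u hu => ?_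
  have hu' : 0 < u := hu
  obtain ⟨h0, h1, h2, h3⟩ := h u hu
  convert! (h2.add (h1.div (hasDerivAt_id u) hu'.ne')).add (h0.const_mul l) using 1
  simp only [id]
  field_simp at h3 ⊢
  linarith

lemma isBesselSolution_sub_of_first_integral {l k : ℝ} (hl : l ≠ 0) {z z₁ z₂ : ℝ → ℝ}
    (h0 : ∀ u, 0 < u → HasDerivAt z (z₁ u) u) (h1 : ∀ u, 0 < u → HasDerivAt z₁ (z₂ u) u)
    (hk : ∀ u, 0 < u → z₂ u + z₁ u / u + l * z u = k) :
    IsBesselSolution l (fun u => z u - k / l) z₁ := by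
  refine fun u hu => ⟨(h0 u hu).sub_const _, (h1 u hu).congr_deriv ?_⟩
  have : l * (k / l) = k := by field_simp
  linear_combination hk u hu - this

/-- For `k` the value of the first integral with `l = 0`, the equation reads `(u z')' = k u`. -/
lemma eq_add_log_of_first_integral {k : ℝ} {z z₁ z₂ : ℝ → ℝ}
    (h0 : ∀ u, 0 < u → HasDerivAt z (z₁ u) u) (h1 : ∀ u, 0 < u → HasDerivAt z₁ (z₂ u) u)
    (hk : ∀ u, 0 < u → z₂ u + z₁ u / u = k) :
    ∃ z₀ b, ∀ u, 0 < u → z u = z₀ + k / 4 * u ^ 2 + b * Real.log u := by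
  obtain ⟨b, hb⟩ : ∃ b, ∀ u ∈ Set.Ioi (0 : ℝ), u * z₁ u - k / 2 * u ^ 2 = b := by
    refine exists_eq_of_hasDerivAt_zero isOpen_Ioi isPreconnected_Ioi fun u hu => ?_
    have hu' : 0 < u := hu
    convert! ((hasDerivAt_id u).mul (h1 u hu)).sub ((hasDerivAt_pow 2 u).const_mul (k / 2)) using 1
    rw [← hk u hu]
    simp only [id]
    push_cast
    field_simp
    ring
  obtain ⟨z₀, hz₀⟩ : ∃ z₀, ∀ u ∈ Set.Ioi (0 : ℝ), z u - k / 4 * u ^ 2 - b * Real.log u = z₀ := by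
    refine exists_eq_of_hasDerivAt_zero isOpen_Ioi isPreconnected_Ioi fun u hu => ?_
    have hu' : 0 < u := hu
    convert! ((h0 u hu).sub ((hasDerivAt_pow 2 u).const_mul (k / 4))).sub
      ((Real.hasDerivAt_log hu'.ne').const_mul b) using 1
    rw [← hb u hu]
    push_cast
    field_simp
    ring
  exact ⟨z₀, b, fun u hu => by linear_combination hz₀ u hu⟩

lemma not_boundedNearAxis_log : ¬ BoundedNearAxis Real.log := by
  rintro ⟨ε, hε, B, hB⟩
  obtain ⟨u, hu, hu'⟩ := ((Real.tendsto_log_nhdsGT_zero.eventually_lt_atBot (-B)).and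
    (Ioo_mem_nhdsGT hε)).exists
  have := hB u hu'.1 hu'.2
  linarith [neg_abs_le (Real.log u)]

lemma not_boundedAtInfinity_of_tendsto {f : ℝ → ℝ} (hf : Tendsto f atTop atTop) :
    ¬ BoundedAtInfinity f := by
  rintro ⟨R, B, hB⟩
  obtain ⟨u, hu, hu0, hR⟩ := ((hf.eventually_gt_atTop B).and
    ((eventually_gt_atTop 0).and (eventually_gt_atTop R))).exists
  linarith [hB u hu0 hR, le_abs_self (f u)]

lemma boundedNearAxis_sq : BoundedNearAxis fun u => u ^ 2 :=
  BoundedNearAxis.of_tendsto (((continuous_pow 2).tendsto 0).mono_left nhdsWithin_le_nhds)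

/-- The combination `z (4 u) - 2 z (2 u) + z u` cancels the logarithm and isolates the quadratic
term. -/
lemma eq_zero_of_boundedAtInfinity_sq_add_log {z : ℝ → ℝ} {z₀ a b : ℝ}
    (h : ∀ u, 0 < u → z u = z₀ + a * u ^ 2 + b * Real.log u) (hz : BoundedAtInfinity z) :
    a = 0 ∧ b = 0 := by
  have ha : a = 0 := by
    by_contra ha
    refine not_boundedAtInfinity_of_tendsto (tendsto_pow_atTop two_ne_zero) ?_
    have h2 := (boundedAtInfinity_comp_mul_iff two_pos).2 hz
    have h4 := (boundedAtInfinity_comp_mul_iff four_pos).2 hz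
    have h24 := h4.of_eq h2 1 (-2) (k := fun u => z (4 * u) - 2 * z (2 * u)) fun u _ => by ring
    refine h24.of_eq hz (1 / (9 * a)) (1 / (9 * a)) fun u hu => ?_
    have l4 : Real.log 4 = 2 * Real.log 2 := by
      rw [show (4 : ℝ) = 2 ^ 2 by norm_num, Real.log_pow]; norm_num
    rw [h u hu, h _ (by positivity : 0 < 2 * u), h _ (by positivity : 0 < 4 * u),
      Real.log_mul two_ne_zero hu.ne', Real.log_mul four_ne_zero hu.ne', l4]
    field_simp
    ring
  refine ⟨ha, ?_⟩
  by_contra hb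
  refine not_boundedAtInfinity_of_tendsto Real.tendsto_log_atTop ?_
  refine hz.of_eq (boundedAtInfinity_const 1) (1 / b) (-z₀ / b) fun u hu => ?_
  rw [h u hu, ha]
  field_simp
  ring

lemma isPlanar_helicoidalSet {z : ℝ → ℝ} {z₀ : ℝ} (hz : ∀ u, 0 < u → z u = z₀) :
    IsPlanar (helicoidalSet z 0) := by
  refine ⟨![0, 0, 1], fun h => by simpa using congrFun h 2, z₀, ?_⟩
  rintro _ ⟨⟨u, t⟩, hu, rfl⟩
  simpa [helicoidal, dotProduct, Fin.sum_univ_three] using hz u hu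

/-- The common eigenvalue of the first two coordinates, and the general solution for the
generating curve, before any boundedness assumption. -/
lemma generatingCurve_classification {z : ℝ → ℝ} {c l₁ l₂ l₃ : ℝ}
    (hz : ContDiffOn ℝ 3 z (Set.Ioi 0))
    (hM : FiniteTypeMinimalNormal (helicoidal z c) helicoidalDomain ![l₁, l₂, l₃])
    (hplane : ¬ IsPlanar (helicoidalSet z c)) :
    l₁ = l₂ ∧ (l₁ ≠ 0 → c = 0) ∧
      ∃ z₀ a b : ℝ,
        (0 < l₁ → ∀ u, 0 < u → z u = z₀ + a * besselJ₀ (√l₁ * u) + b * besselY₀ (√l₁ * u)) ∧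
        (l₁ = 0 → ∀ u, 0 < u → z u = z₀ + a * u ^ 2 + b * Real.log u) ∧
        (l₁ < 0 → ∀ u, 0 < u →
          z u = z₀ + a * besselI₀ (√(-l₁) * u) + b * besselK₀ (√(-l₁) * u)) := by
  obtain ⟨c1, c2, z₁, z₂, z₃, h⟩ := hM.generatingCurve hz
  have hl : l₁ = l₂ := by
    by_cases hne : ∃ u, 0 < u ∧ z₁ u ≠ 0
    · obtain ⟨u, hu, hne⟩ := hne
      obtain ⟨-, -, -, e1, e2⟩ := h u hu
      exact mul_right_cancel₀ hne (by linarith)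
    -- constant height: the surface is a plane unless `c ≠ 0`, which annihilates both eigenvalues
    · push Not at hne
      obtain ⟨z₀, hz₀⟩ := exists_eq_of_hasDerivAt_zero isOpen_Ioi isPreconnected_Ioi
        (fun u hu => hne u hu ▸ (h u hu).1)
      have hc : c ≠ 0 := by
        rintro rfl
        exact hplane (isPlanar_helicoidalSet hz₀)
      rw [(mul_eq_zero.1 c1).resolve_right hc, (mul_eq_zero.1 c2).resolve_right hc]
  refine ⟨hl, fun hl0 => (mul_eq_zero.1 c1).resolve_left hl0, ?_⟩
  have h0 (u : ℝ) (hu : 0 < u) := (h u hu).1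
  have h1 (u : ℝ) (hu : 0 < u) := (h u hu).2.1
  obtain ⟨k, hk⟩ := exists_first_integral (l := l₁) fun u hu =>
    ⟨h0 u hu, h1 u hu, (h u hu).2.2.1, (h u hu).2.2.2.1⟩
  rcases lt_trichotomy l₁ 0 with hneg | h00 | hpos
  · have hw := isBesselSolution_sub_of_first_integral hneg.ne h0 h1 hk
    obtain ⟨a, b, hab⟩ := hw.eq_combination_comp_mul (m := -1)
      (Real.sqrt_pos.2 (neg_pos.2 hneg)) (by rw [Real.sq_sqrt (by linarith)]; ring)
      isBesselSolution_besselI₀ isBesselSolution_besselK₀ tendsto_besselI₀_zero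
      not_boundedNearAxis_besselK₀
    exact ⟨k / l₁, a, b, fun h => by linarith, fun h => by linarith,
      fun _ u hu => by linear_combination hab u hu⟩
  · simp only [h00, zero_mul, add_zero] at hk
    obtain ⟨z₀, b, hb⟩ := eq_add_log_of_first_integral h0 h1 hk
    exact ⟨z₀, k / 4, b, fun h => by linarith, fun _ => hb, fun h => by linarith⟩
  · have hw := isBesselSolution_sub_of_first_integral hpos.ne' h0 h1 hk
    obtain ⟨a, b, hab⟩ := hw.eq_combination_comp_mul (m := 1)
      (Real.sqrt_pos.2 hpos) (by rw [Real.sq_sqrt hpos.le]; ring)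
      isBesselSolution_besselJ₀ isBesselSolution_besselY₀ tendsto_besselJ₀_zero
      not_boundedNearAxis_besselY₀
    exact ⟨k / l₁, a, b, fun _ u hu => by linear_combination hab u hu, fun h => by linarith,
      fun h => by linarith⟩

/-- Boundedness near the axis removes the second solution in each of the three cases. -/
lemma generatingCurve_of_boundedNearAxis {z : ℝ → ℝ} {c l₁ l₂ l₃ : ℝ}
    (hz : ContDiffOn ℝ 3 z (Set.Ioi 0))
    (hM : FiniteTypeMinimalNormal (helicoidal z c) helicoidalDomain ![l₁, l₂, l₃])
    (hplane : ¬ IsPlanar (helicoidalSet z c)) (hb : BoundedNearAxis z) :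
    ∃ z₀ z₁ : ℝ,
        (0 < l₁ → ∀ u, 0 < u → z u = z₀ + z₁ * besselJ₀ (√l₁ * u)) ∧
        (l₁ = 0 → ∀ u, 0 < u → z u = z₀ + z₁ * u ^ 2) ∧
        (l₁ < 0 → ∀ u, 0 < u → z u = z₀ + z₁ * besselI₀ (√(-l₁) * u)) := by
  obtain ⟨-, -, z₀, A, B, hp, h0, hn⟩ := generatingCurve_classification hz hM hplane
  refine ⟨z₀, A, fun hl u hu => ?_, fun hl u hu => ?_, fun hl u hu => ?_⟩
  · have hB := eq_zero_of_boundedNearAxis (Real.sqrt_pos.2 hl) tendsto_besselJ₀_zero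
      not_boundedNearAxis_besselY₀ (hp hl) hb
    rw [hp hl u hu, hB]; ring
  · have hB : B = 0 := by
      by_contra hB
      refine not_boundedNearAxis_log ?_
      have h1 : BoundedNearAxis fun u => z u - A * u ^ 2 :=
        hb.of_eq boundedNearAxis_sq 1 (-A) fun u _ => by ring
      refine h1.of_eq (boundedNearAxis_const 1) (1 / B) (-z₀ / B) fun u hu => ?_
      rw [h0 hl u hu]
      field_simp
      ring
    rw [h0 hl u hu, hB]; ring
  · have hB := eq_zero_of_boundedNearAxis (Real.sqrt_pos.2 (neg_pos.2 hl)) tendsto_besselI₀_zero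
      not_boundedNearAxis_besselK₀ (hn hl) hb
    rw [hn hl u hu, hB]; ring

lemma generatingCurve_of_boundedAtInfinity {z : ℝ → ℝ} {c l₁ l₂ l₃ : ℝ}
    (hz : ContDiffOn ℝ 3 z (Set.Ioi 0))
    (hM : FiniteTypeMinimalNormal (helicoidal z c) helicoidalDomain ![l₁, l₂, l₃])
    (hplane : ¬ IsPlanar (helicoidalSet z c)) (hb : BoundedAtInfinity z) :
    (0 < l₁ ∧ c = 0 ∧ ∃ z₀ z₁ z₂ : ℝ, ∀ u, 0 < u →
      z u = z₀ + z₁ * besselJ₀ (√l₁ * u) + z₂ * besselY₀ (√l₁ * u)) ∨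
    (l₁ < 0 ∧ c = 0 ∧ ∃ z₀ z₂ : ℝ, ∀ u, 0 < u → z u = z₀ + z₂ * besselK₀ (√(-l₁) * u)) ∨
    (l₁ = 0 ∧ c ≠ 0 ∧ ∃ z₀ : ℝ, ∀ u, 0 < u → z u = z₀) := by
  obtain ⟨-, hc, z₀, A, B, hp, h0, hn⟩ := generatingCurve_classification hz hM hplane
  rcases lt_trichotomy l₁ 0 with hl | hl | hl
  · have hA := eq_zero_of_boundedAtInfinity (Real.sqrt_pos.2 (neg_pos.2 hl))
      boundedAtInfinity_besselK₀ not_boundedAtInfinity_besselI₀ (hn hl) hb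
    exact Or.inr (Or.inl ⟨hl, hc hl.ne, z₀, B, fun u hu => by rw [hn hl u hu, hA]; ring⟩)
  · obtain ⟨hA, hB⟩ := eq_zero_of_boundedAtInfinity_sq_add_log (h0 hl) hb
    have hconst (u : ℝ) (hu : 0 < u) : z u = z₀ := by rw [h0 hl u hu, hA, hB]; ring
    refine Or.inr (Or.inr ⟨hl, ?_, z₀, hconst⟩)
    rintro rfl
    exact hplane (isPlanar_helicoidalSet hconst)
  · exact Or.inl ⟨hl, hc hl.ne', z₀, A, B, hp hl⟩

end SimplyIsotropic

theorem mainTheorem9 (z : ℝ → ℝ) (c l₁ l₂ l₃ : ℝ)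
    (hz : ContDiffOn ℝ 3 z (Set.Ioi 0))
    (hM : SimplyIsotropic.FiniteTypeMinimalNormal (SimplyIsotropic.helicoidal z c)
      SimplyIsotropic.helicoidalDomain ![l₁, l₂, l₃])
    (hplane : ¬ SimplyIsotropic.IsPlanar (SimplyIsotropic.helicoidalSet z c)) :
    -- bounded near the screw axis
    (SimplyIsotropic.BoundedNearAxis z →
      l₁ = l₂ ∧ (l₁ ≠ 0 → c = 0) ∧
      ∃ z₀ z₁ : ℝ,
        (0 < l₁ → ∀ u, 0 < u → z u = z₀ + z₁ * SimplyIsotropic.besselJ₀ (√l₁ * u)) ∧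
        (l₁ = 0 → ∀ u, 0 < u → z u = z₀ + z₁ * u ^ 2) ∧
        (l₁ < 0 → ∀ u, 0 < u → z u = z₀ + z₁ * SimplyIsotropic.besselI₀ (√(-l₁) * u))) ∧
    -- bounded at infinity; the last alternative is the right helicoid
    (SimplyIsotropic.BoundedAtInfinity z →
      l₁ = l₂ ∧
      ((0 < l₁ ∧ c = 0 ∧ ∃ z₀ z₁ z₂ : ℝ, ∀ u, 0 < u →
          z u = z₀ + z₁ * SimplyIsotropic.besselJ₀ (√l₁ * u)
            + z₂ * SimplyIsotropic.besselY₀ (√l₁ * u)) ∨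
       (l₁ < 0 ∧ c = 0 ∧ ∃ z₀ z₂ : ℝ, ∀ u, 0 < u →
          z u = z₀ + z₂ * SimplyIsotropic.besselK₀ (√(-l₁) * u)) ∨
       (l₁ = 0 ∧ c ≠ 0 ∧ ∃ z₀ : ℝ, ∀ u, 0 < u → z u = z₀))) ∧
    -- bounded near the screw axis and at infinity; the last alternative is the right helicoid
    (SimplyIsotropic.BoundedNearAxis z → SimplyIsotropic.BoundedAtInfinity z →
      l₁ = l₂ ∧
      ((0 < l₁ ∧ c = 0 ∧ ∃ z₀ z₁ : ℝ, ∀ u, 0 < u →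
          z u = z₀ + z₁ * SimplyIsotropic.besselJ₀ (√l₁ * u)) ∨
       (l₁ = 0 ∧ c ≠ 0 ∧ ∃ z₀ : ℝ, ∀ u, 0 < u → z u = z₀))) := by
  obtain ⟨hl, hc, -⟩ := SimplyIsotropic.generatingCurve_classification hz hM hplane
  refine ⟨fun hb => ⟨hl, hc, SimplyIsotropic.generatingCurve_of_boundedNearAxis hz hM hplane hb⟩,
    fun hb => ⟨hl, SimplyIsotropic.generatingCurve_of_boundedAtInfinity hz hM hplane hb⟩,
    fun hb hb' => ⟨hl, ?_⟩⟩
  obtain ⟨z₀, z₁, hp, -, hn⟩ :=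
    SimplyIsotropic.generatingCurve_of_boundedNearAxis hz hM hplane hb
  rcases SimplyIsotropic.generatingCurve_of_boundedAtInfinity hz hM hplane hb' with
    ⟨h, hc0, -⟩ | ⟨h, hc0, -⟩ | h
  · exact Or.inl ⟨h, hc0, z₀, z₁, hp h⟩
  -- `z₀ + z₁ I₀` is bounded at infinity only if it is constant, and then the surface is a plane
  · have hz₁ := SimplyIsotropic.eq_zero_of_boundedAtInfinity (A := z₁) (B := 0)
      (Real.sqrt_pos.2 (neg_pos.2 h)) SimplyIsotropic.boundedAtInfinity_besselK₀
      SimplyIsotropic.not_boundedAtInfinity_besselI₀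
      (fun u hu => by rw [hn h u hu]; ring) hb'
    subst hc0
    refine absurd (SimplyIsotropic.isPlanar_helicoidalSet (z₀ := z₀) fun u hu => ?_) hplane
    rw [hn h u hu, hz₁]; ring
  · exact Or.inr h
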